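/- Write $M_n$ for the space of complex $n\times n$ matrices. Let $S\subseteq M_n$, and let $A_1,\dots,A_d\in M_n$ be linearly independent matrices such that $S\subseteq\operatorname{span}\{A_1,\dots,A_d\}$, while $S$ is not contained in the span of any proper sub-collection of them. The eigen-surface of $S$ is $$ES(S)=\{(\alpha_1,\dots,\alpha_d,\lambda)\in\mathbb{C}^{d+1} : \alpha_1A_1+\dots+\alpha_dA_d\in S,\ \lambda\text{ is an eigenvalue of }\alpha_1A_1+\dots+\alpha_dA_d\}.$$ (The choice of $A_1,\dots,A_d$ is suppressed in the notation; everything below holds for every such choice.) The set $S$ is called transitive if, whenever $(\alpha,\lambda)$ and $(\alpha,\mu)$ lie in the same path-component of $ES(S)$, then $\lambda=\mu$. A path-component $\mathcal K$ of $ES(S)$ is called a $k$-component if $k$ is the number of eigenvalues $\lambda$, counted with algebraic multiplicity, of a matrix $A=\sum_i\alpha_iA_i\in S$ for which $(\alpha,\lambda)\in\mathcal K$ (for path-connected $S$ this number does not depend on $A\in S$). The multiplicity list of $A\in M_n$ is $(a_n,\dots,a_1)$, where $a_i$ is the number of distinct eigenvalues of $A$ of algebraic multiplicity $i$. Let $S\subseteq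 M_n$ be simply connected. 1. Let $A:[0,1]\to M_n$ be a closed path in $S$, that is, a continuous map with $A(0)=A(1)$ and $A(x)\in S$ for all $x$. If its image $A([0,1])$ is not transitive, then not all matrices in $S$ have the same multiplicity list. 2. If $\mathcal K$ is a $k$-component of $ES(S)$ with $k>1$, then $\mathcal K$ contains an eigenvalue of algebraic multiplicity $>1$: there is $(\alpha,\lambda)\in\mathcal K$ such that $\lambda$ is an eigenvalue of $\sum_i\alpha_iA_i$ of algebraic multiplicity $>1$. -/

import Mathlib

noncomputable section

namespace EigenSurface

/-- The algebraic multiplicity of `l` as an eigenvalue of `A`. -/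
def algMult {n : ℕ} (A : Matrix (Fin n) (Fin n) ℂ) (l : ℂ) : ℕ :=
  A.charpoly.rootMultiplicity l

/-- The number of distinct eigenvalues of `A` of algebraic multiplicity `i`. -/
def numEigen {n : ℕ} (A : Matrix (Fin n) (Fin n) ℂ) (i : ℕ) : ℕ :=
  Set.ncard {l : ℂ | l ∈ spectrum ℂ A ∧ algMult A l = i}

/-- The multiplicity list `(a_n, …, a_1)` of `A`, where `a_i` is the number of distinct
eigenvalues of `A` of algebraic multiplicity `i`. -/
def multiplicityList {n : ℕ} (A : Matrix (Fin n) (Fin n) ℂ) : Fin n → ℕ :=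
  fun j => numEigen A (n - (j : ℕ))

/-- The linear combination `α_1 A_1 + ⋯ + α_d A_d`. -/
def comb {n d : ℕ} (b : Fin d → Matrix (Fin n) (Fin n) ℂ) (α : Fin d → ℂ) :
    Matrix (Fin n) (Fin n) ℂ :=
  ∑ i, α i • b i

/-- The matrices `b 0, …, b (d - 1)` may be used as coordinates for the eigen-surface of `S`:
they are linearly independent, and `S` lies in their span but not in the span of any proper
sub-collection of them. -/
structure IsRepresentation {n d : ℕ} (S : Set (Matrix (Fin n) (Fin n) ℂ))
    (b : Fin d → Matrix (Fin n) (Fin n) ℂ) : Prop where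
  linearIndependent : LinearIndependent ℂ b
  subset_span : S ⊆ Submodule.span ℂ (Set.range b)
  minimal : ∀ J : Set (Fin d), J ≠ Set.univ → ¬ S ⊆ Submodule.span ℂ (b '' J)

/-- The eigen-surface `ES(S)` in the coordinates given by the matrices `b`. -/
def eigenSurface {n d : ℕ} (b : Fin d → Matrix (Fin n) (Fin n) ℂ)
    (S : Set (Matrix (Fin n) (Fin n) ℂ)) : Set ((Fin d → ℂ) × ℂ) :=
  {p | comb b p.1 ∈ S ∧ p.2 ∈ spectrum ℂ (comb b p.1)}

/-- `K` is a path-component of the eigen-surface of `S`. -/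
def IsEigenComponent {n d : ℕ} (b : Fin d → Matrix (Fin n) (Fin n) ℂ)
    (S : Set (Matrix (Fin n) (Fin n) ℂ)) (K : Set ((Fin d → ℂ) × ℂ)) : Prop :=
  ∃ p ∈ eigenSurface b S, K = pathComponentIn (eigenSurface b S) p

/-- Two points of the eigen-surface of `S` are paired if they lie in the same
path-component. -/
def Paired {n d : ℕ} (b : Fin d → Matrix (Fin n) (Fin n) ℂ)
    (S : Set (Matrix (Fin n) (Fin n) ℂ)) (p q : (Fin d → ℂ) × ℂ) : Prop :=
  ∃ K, IsEigenComponent b S K ∧ p ∈ K ∧ q ∈ K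

/-- `S` is transitive: paired eigenvalues of one matrix of `S` are equal. -/
def IsTransitive {n d : ℕ} (b : Fin d → Matrix (Fin n) (Fin n) ℂ)
    (S : Set (Matrix (Fin n) (Fin n) ℂ)) : Prop :=
  ∀ (α : Fin d → ℂ) (l m : ℂ), comb b α ∈ S → Paired b S (α, l) (α, m) → l = m

open Classical in
/-- The number of eigenvalues, counted with algebraic multiplicity, that the matrix with
coordinates `α` has in `K`. -/
def countIn {n d : ℕ} (b : Fin d → Matrix (Fin n) (Fin n) ℂ)
    (K : Set ((Fin d → ℂ) × ℂ)) (α : Fin d → ℂ) : ℕ :=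
  ((comb b α).charpoly.roots.filter (fun l => (α, l) ∈ K)).card

/-- `K` is a `k`-component of `S`: a path-component of the eigen-surface that contains `k`
eigenvalues, counted with algebraic multiplicity, of some matrix of `S`.  For path-connected `S`
the number of eigenvalues in `K` is the same for all matrices of `S`, so that here "some" and
"every" give the same notion. -/
def IsKComponent {n d : ℕ} (b : Fin d → Matrix (Fin n) (Fin n) ℂ)
    (S : Set (Matrix (Fin n) (Fin n) ℂ)) (k : ℕ) (K : Set ((Fin d → ℂ) × ℂ)) : Prop :=
  IsEigenComponent b S K ∧ ∃ α : Fin d → ℂ, comb b α ∈ S ∧ countIn b K α = k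

end EigenSurface

end

/-! The eigenvalues of the matrices in `S` form a branched cover of `S`, and both claims are the
monodromy principle away from branching. If no point reachable from `(x, l)` is ramified, then paths
in the simply connected base lift uniquely from `(x, l)`. Contracting the projection of a path from
`(x, l)` to `(x, m)` then forces `l = m` (`IsRootSet.eq_of_joinedIn`).

Both parts are proved by contraposition and differ only in why branching is absent. In part 1, equal
multiplicity lists give a constant number of distinct eigenvalues, so none can split or merge
(`IsRootSet.isUnramifiedAt_of_ncard_eq`). In part 2, an eigenvalue that is simple is locally the
only root near itself (`isUnramifiedAt_of_algMult_le_one`). A component of simple eigenvalues thus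
meets each matrix at most once, so `k ≤ 1`. -/

section

open Filter Topology Set

/-! ### Root sets, ramification and local sections -/

/-- A closed, locally bounded relation `R ⊆ X × ℂ` with finite fibres, whose points persist under
small changes of the base point: the abstract behaviour of the roots of a continuous family of
monic polynomials of fixed degree. -/
structure IsRootSet {X : Type*} [TopologicalSpace X] (R : Set (X × ℂ)) : Prop where
  isClosed : IsClosed R
  finite_fiber : ∀ x, {l | (x, l) ∈ R}.Finite
  locally_bounded : ∀ x, ∃ C : ℝ, ∀ᶠ y in 𝓝 x, ∀ l, (y, l) ∈ R → ‖l‖ ≤ C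
  eventually_exists : ∀ q ∈ R, ∀ ε > 0, ∀ᶠ x in 𝓝 q.1, ∃ l, (x, l) ∈ R ∧ dist l q.2 < ε

/-- Near `q`, the relation `R` has at most one point over each base point. -/
def IsUnramifiedAt {X : Type*} [TopologicalSpace X] (R : Set (X × ℂ)) (q : X × ℂ) : Prop :=
  ∃ W ∈ 𝓝 q, InjOn Prod.fst (W ∩ R)

theorem IsRootSet.preimage {X Y : Type*} [TopologicalSpace X] [TopologicalSpace Y]
    {R : Set (X × ℂ)} (hR : IsRootSet R) {g : Y → X} (hg : Continuous g) :
    IsRootSet {q : Y × ℂ | (g q.1, q.2) ∈ R} where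
  isClosed := hR.isClosed.preimage (by fun_prop)
  finite_fiber y := hR.finite_fiber (g y)
  locally_bounded y := by
    obtain ⟨C, hC⟩ := hR.locally_bounded (g y)
    exact ⟨C, hg.continuousAt.eventually hC⟩
  eventually_exists q hq ε hε :=
    hg.continuousAt.eventually (hR.eventually_exists (g q.1, q.2) hq ε hε)

theorem IsUnramifiedAt.preimage {X Y : Type*} [TopologicalSpace X] [TopologicalSpace Y]
    {R : Set (X × ℂ)} {g : Y → X} (hg : Continuous g) {q : Y × ℂ}
    (h : IsUnramifiedAt R (g q.1, q.2)) :
    IsUnramifiedAt {q : Y × ℂ | (g q.1, q.2) ∈ R} q := by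
  obtain ⟨W, hW, hinj⟩ := h
  have hc : Continuous (fun q : Y × ℂ => (g q.1, q.2)) := by fun_prop
  refine ⟨_, hc.continuousAt.preimage_mem_nhds hW, ?_⟩
  rintro ⟨y, l⟩ ⟨h1, h2⟩ ⟨y', l'⟩ ⟨h3, h4⟩ (rfl : y = y')
  have := hinj ⟨h1, h2⟩ ⟨h3, h4⟩ rfl
  simpa using this

/-- Near an unramified point, a root set is the graph of a continuous function. -/
theorem IsRootSet.exists_local_section {X : Type*} [TopologicalSpace X] {R : Set (X × ℂ)}
    (hR : IsRootSet R) {q : X × ℂ} (hq : q ∈ R) (hu : IsUnramifiedAt R q) :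
    ∃ τ : X → ℂ, τ q.1 = q.2 ∧ ∀ᶠ x in 𝓝 q.1, (x, τ x) ∈ R ∧ ContinuousAt τ x := by
  classical
  obtain ⟨W, hW, hinj⟩ := hu
  obtain ⟨U, hU, V, hV, hUV⟩ := mem_nhds_prod_iff.1 hW
  obtain ⟨ε, hε, hεV⟩ := Metric.mem_nhds_iff.1 hV
  have huniq : ∀ x ∈ U, ∀ l l' : ℂ, (x, l) ∈ R → (x, l') ∈ R → dist l q.2 < ε →
      dist l' q.2 < ε → l = l' := fun x hx l l' h h' hl hl' =>
    congrArg Prod.snd (hinj ⟨hUV ⟨hx, hεV (Metric.mem_ball.2 hl)⟩, h⟩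
      ⟨hUV ⟨hx, hεV (Metric.mem_ball.2 hl')⟩, h'⟩ rfl)
  let τ : X → ℂ := fun x =>
    if h : ∃ l, (x, l) ∈ R ∧ dist l q.2 < ε then h.choose else q.2
  have hτ : ∀ x, (∃ l, (x, l) ∈ R ∧ dist l q.2 < ε) → (x, τ x) ∈ R ∧ dist (τ x) q.2 < ε := by
    intro x h
    simp only [τ, dif_pos h]
    exact h.choose_spec
  have hev : ∀ᶠ x in 𝓝 q.1, x ∈ U ∧ ∃ l, (x, l) ∈ R ∧ dist l q.2 < ε :=
    (eventually_mem_set.2 hU).and (hR.eventually_exists q hq ε hε)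
  refine ⟨τ, ?_, ?_⟩
  · have h : ∃ l, (q.1, l) ∈ R ∧ dist l q.2 < ε := ⟨q.2, hq, by simpa using hε⟩
    exact huniq _ (mem_of_mem_nhds hU) _ _ (hτ _ h).1 hq (hτ _ h).2 (by simpa using hε)
  · filter_upwards [hev.eventually_nhds] with x hx
    have hx0 := hτ x hx.self_of_nhds.2
    refine ⟨hx0.1, Metric.tendsto_nhds.2 fun δ hδ => ?_⟩
    have hpos : 0 < min δ (ε - dist (τ x) q.2) := lt_min hδ (sub_pos.2 hx0.2)
    filter_upwards [hx, hR.eventually_exists (x, τ x) hx0.1 _ hpos] with y hy hy'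
    obtain ⟨l, hl, hd⟩ := hy'
    have hlq : dist l q.2 < ε := by
      have h1 := dist_triangle l (τ x) q.2
      have h2 := lt_of_lt_of_le hd (min_le_right _ _)
      linarith
    have := huniq y hy.1 _ _ (hτ y hy.2).1 hl (hτ y hy.2).2 hlq
    rw [this]
    exact lt_of_lt_of_le hd (min_le_left _ _)

/-! ### Lifting paths over an interval -/

/-- `σ` is a continuous selection from `R` over `[0, t]` that starts at `l`. -/
structure IsLiftOn (R : Set (ℝ × ℂ)) (l : ℂ) (σ : ℝ → ℂ) (t : ℝ) : Prop where
  continuousOn : ContinuousOn σ (Icc 0 t)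
  map_zero : σ 0 = l
  mem : ∀ s ∈ Icc 0 t, (s, σ s) ∈ R

theorem IsLiftOn.mono {R : Set (ℝ × ℂ)} {l : ℂ} {σ : ℝ → ℂ} {s t : ℝ} (h : IsLiftOn R l σ t)
    (hst : s ≤ t) : IsLiftOn R l σ s :=
  ⟨h.1.mono (Icc_subset_Icc_right hst), h.2, fun u hu => h.3 u ⟨hu.1, hu.2.trans hst⟩⟩

/-- The agreement set is closed. It also extends to the right of each of its points `x`, since both
graphs stay in a neighbourhood of `(x, σ x)` on which the projection is injective. -/
theorem IsLiftOn.eqOn {R : Set (ℝ × ℂ)} {l : ℂ} {σ τ : ℝ → ℂ} {t : ℝ}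
    (hσ : IsLiftOn R l σ t) (hτ : IsLiftOn R l τ t)
    (hu : ∀ s ∈ Icc 0 t, IsUnramifiedAt R (s, σ s)) : EqOn σ τ (Icc 0 t) := by
  have key : Icc 0 t ⊆ {s | σ s = τ s} := by
    refine IsClosed.Icc_subset_of_forall_exists_gt ?_ (hσ.2.trans hτ.2.symm) ?_
    · have := (hσ.1.prodMk hτ.1).preimage_isClosed_of_isClosed isClosed_Icc
        (isClosed_diagonal (X := ℂ))
      rw [inter_comm]
      exact this
    · rintro x ⟨hx, hx0, hxt⟩ y hy
      have hxI : x ∈ Icc 0 t := ⟨hx0, hxt.le⟩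
      obtain ⟨W, hW, hinj⟩ := hu x hxI
      have hI : Icc 0 t ∈ 𝓝[>] x :=
        mem_of_superset (Ioc_mem_nhdsGT hxt) fun z hz => ⟨hx0.trans hz.1.le, hz.2⟩
      have hcσ : Tendsto (fun s => (s, σ s)) (𝓝[>] x) (𝓝 (x, σ x)) :=
        (tendsto_id.mono_left nhdsWithin_le_nhds).prodMk_nhds
          ((hσ.1 x hxI).mono_of_mem_nhdsWithin hI)
      have hcτ : Tendsto (fun s => (s, τ s)) (𝓝[>] x) (𝓝 (x, σ x)) := by
        have hx' : σ x = τ x := hx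
        rw [hx']
        exact (tendsto_id.mono_left nhdsWithin_le_nhds).prodMk_nhds
          ((hτ.1 x hxI).mono_of_mem_nhdsWithin hI)
      obtain ⟨s, h1, h2, h3, h4⟩ := ((hcσ.eventually hW).and ((hcτ.eventually hW).and
        ((eventually_mem_set.2 hI).and (eventually_mem_set.2 (Ioc_mem_nhdsGT hy))))).exists
      exact ⟨s, congrArg Prod.snd (hinj ⟨h1, hσ.3 s h3⟩ ⟨h2, hτ.3 s h3⟩ rfl), h4⟩
  exact key

/-- A continuous selection from a root set over `[0, T)` converges at `T`. -/
theorem IsRootSet.exists_tendsto {R : Set (ℝ × ℂ)} (hR : IsRootSet R) {T : ℝ} (hT : 0 < T)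
    {σ : ℝ → ℂ} (hc : ContinuousOn σ (Ico 0 T)) (hm : ∀ s ∈ Ico 0 T, (s, σ s) ∈ R) :
    ∃ m, (T, m) ∈ R ∧ Tendsto σ (𝓝[<] T) (𝓝 m) := by
  have hI : ∀ᶠ s in 𝓝[<] T, s ∈ Ico 0 T :=
    mem_of_superset (Ioo_mem_nhdsLT hT) Ioo_subset_Ico_self
  obtain ⟨C, hC⟩ := hR.locally_bounded T
  have hb : ∀ᶠ s in 𝓝[<] T, σ s ∈ Metric.closedBall (0 : ℂ) C := by
    filter_upwards [hI, hC.filter_mono nhdsWithin_le_nhds] with s hs h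
    simpa using h _ (hm s hs)
  -- Local boundedness yields a cluster point `m`, and closedness of `R` puts it in the fibre over
  -- `T`.
  obtain ⟨m, -, hcl⟩ := (isCompact_closedBall (0 : ℂ) C).exists_mapClusterPt
    (le_principal_iff.2 hb : map σ (𝓝[<] T) ≤ 𝓟 _)
  have hfr : ∀ ε > 0, ∃ᶠ s in 𝓝[<] T, dist (σ s) m < ε := fun ε hε =>
    mapClusterPt_iff_frequently.1 hcl _ (Metric.ball_mem_nhds m hε)
  have hmR : (T, m) ∈ R := by
    refine hR.isClosed.closure_subset (mem_closure_iff_nhds.2 fun W hW => ?_)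
    obtain ⟨U, hU, V, hV, hUV⟩ := mem_nhds_prod_iff.1 hW
    obtain ⟨ε, hε, hεV⟩ := Metric.mem_nhds_iff.1 hV
    obtain ⟨s, h1, h2, h3⟩ := ((hfr ε hε).and_eventually
      (hI.and ((eventually_mem_set.2 hU).filter_mono nhdsWithin_le_nhds))).exists
    exact ⟨(s, σ s), hUV ⟨h3, hεV h1⟩, hm s h2⟩
  refine ⟨m, hmR, ?_⟩
  obtain ⟨r, hr, hrR⟩ : ∃ r > 0, ∀ l, (T, l) ∈ R → dist l m < r → l = m := by
    have hfin := (hR.finite_fiber T).subset (sdiff_subset (t := {m}))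
    have : ({l | (T, l) ∈ R} \ {m})ᶜ ∈ 𝓝 m := hfin.isClosed.isOpen_compl.mem_nhds (by simp)
    obtain ⟨r, hr, h⟩ := Metric.mem_nhds_iff.1 this
    refine ⟨r, hr, fun l hl hd => ?_⟩
    by_contra hne
    exact h hd ⟨hl, hne⟩
  refine Metric.tendsto_nhds.2 fun δ hδ => ?_
  obtain ⟨ε, hε, hεδ, hεr⟩ : ∃ ε > 0, ε ≤ δ ∧ ε < r :=
    ⟨min δ (r / 2), by positivity, min_le_left _ _,
      lt_of_le_of_lt (min_le_right _ _) (by linarith)⟩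
  -- As `m` is isolated in its fibre, a small sphere around it misses that fibre, and by compactness
  -- all nearby ones. The selection is inside this sphere at some times near `T` and by the
  -- intermediate value theorem cannot cross it later or earlier.
  have hsph : ∀ᶠ s in 𝓝 T, ∀ l ∈ Metric.sphere m ε, (s, l) ∈ Rᶜ := by
    refine (isCompact_sphere m ε).eventually_forall_of_forall_eventually fun l hl => ?_
    refine hR.isClosed.isOpen_compl.mem_nhds fun hlR => ?_
    have hlm := hrR l hlR (by rw [Metric.mem_sphere.1 hl]; exact hεr)
    rw [hlm] at hl
    simp at hl
    exact hε.ne hl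
  obtain ⟨η, hη, hηs⟩ := Metric.eventually_nhds_iff.1 hsph
  have hJ : Ioo (max 0 (T - η)) T ∈ 𝓝[<] T := Ioo_mem_nhdsLT (max_lt hT (by linarith))
  have hJI : Ioo (max 0 (T - η)) T ⊆ Ico 0 T := fun s hs =>
    ⟨(le_max_left _ _).trans hs.1.le, hs.2⟩
  obtain ⟨s₀, hs₀, hs₀J⟩ := ((hfr ε hε).and_eventually (eventually_mem_set.2 hJ)).exists
  have hne : ∀ s ∈ Ioo (max 0 (T - η)) T, dist (σ s) m ≠ ε := by
    intro s hs he
    refine hηs (y := s) ?_ (σ s) he (hm s (hJI hs))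
    have := (le_max_right _ _).trans_lt hs.1
    rw [Real.dist_eq, abs_lt]
    constructor <;> linarith [hs.2]
  filter_upwards [hJ] with s hs
  refine lt_of_lt_of_le ?_ hεδ
  by_contra hge
  have hconn : IsPreconnected (Ioo (max 0 (T - η)) T) := isPreconnected_Ioo
  have hcd : ContinuousOn (fun s => dist (σ s) m) (Ioo (max 0 (T - η)) T) :=
    continuous_dist.comp_continuousOn ((hc.mono hJI).prodMk continuousOn_const)
  obtain ⟨u, hu, hue⟩ := hconn.intermediate_value hs₀J hs hcd ⟨hs₀.le, not_lt.1 hge⟩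
  exact hne u hu hue

/-- Path lifting: if every partial lift ends at an unramified point, then the lift exists over the
whole unit interval. -/
theorem IsRootSet.exists_isLiftOn {R : Set (ℝ × ℂ)} (hR : IsRootSet R) {l : ℂ} (hl : (0, l) ∈ R)
    (hu : ∀ t ∈ Icc (0 : ℝ) 1, ∀ σ, IsLiftOn R l σ t → IsUnramifiedAt R (t, σ t)) :
    ∃ σ, IsLiftOn R l σ 1 := by
  have huniq : ∀ t ∈ Icc (0 : ℝ) 1, ∀ σ τ, IsLiftOn R l σ t → IsLiftOn R l τ t →
      EqOn σ τ (Icc 0 t) := fun t ht σ τ hσ hτ =>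
    hσ.eqOn hτ fun s hs => hu s ⟨hs.1, hs.2.trans ht.2⟩ σ (hσ.mono hs.2)
  have h0 : (0 : ℝ) ∈ {t | ∃ σ, IsLiftOn R l σ t} :=
    ⟨fun _ => l, by fun_prop, rfl, fun s hs => by
      obtain rfl : s = 0 := le_antisymm hs.2 hs.1
      exact hl⟩
  suffices Icc (0 : ℝ) 1 ⊆ {t | ∃ σ, IsLiftOn R l σ t} from this ⟨zero_le_one, le_rfl⟩
  refine IsClosed.Icc_subset_of_forall_exists_gt ?_ h0 ?_
  · refine isClosed_of_closure_subset fun T hT => ?_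
    have hTI : T ∈ Icc (0 : ℝ) 1 := isClosed_Icc.closure_subset (closure_mono inter_subset_right hT)
    refine ⟨?_, hTI⟩
    rcases hTI.1.eq_or_lt with rfl | hT0
    · exact h0
    have hlt : ∀ u, u < T → ∃ σ, IsLiftOn R l σ u := by
      intro u huT
      obtain ⟨v, hv, ⟨σ, hσ⟩, -⟩ := mem_closure_iff_nhds.1 hT _ (Ioi_mem_nhds huT)
      exact ⟨σ, hσ.mono (le_of_lt hv)⟩
    -- The lifts over the intervals `[0, u]` agree by uniqueness, so the diagonal `t ↦ f t t` is a
    -- lift over `[0, T)`; its limit at `T` completes it.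
    choose! f hf using hlt
    have hagree : ∀ u ∈ Ico 0 T, EqOn (fun t => f t t) (f u) (Icc 0 u) := fun u huT t ht =>
      huniq t ⟨ht.1, ht.2.trans (huT.2.le.trans hTI.2)⟩ _ _ (hf t (ht.2.trans_lt huT.2))
        ((hf u huT.2).mono ht.2) ⟨ht.1, le_rfl⟩
    have hmem : ∀ s ∈ Ico 0 T, (s, f s s) ∈ R := fun s hs => (hf s hs.2).3 s ⟨hs.1, le_rfl⟩
    have hcont : ContinuousOn (fun t => f t t) (Ico 0 T) := by
      intro t ht
      have htv : t < (t + T) / 2 := by linarith [ht.2]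
      have hvT : (t + T) / 2 < T := by linarith [ht.2]
      have hv : (t + T) / 2 ∈ Ico 0 T := ⟨by linarith [ht.1], hvT⟩
      have h1 : ContinuousWithinAt (fun t => f t t) (Icc 0 ((t + T) / 2)) t :=
        (((hf _ hvT).1.congr (hagree _ hv)) t ⟨ht.1, htv.le⟩)
      refine h1.mono_of_mem_nhdsWithin ?_
      filter_upwards [self_mem_nhdsWithin, mem_nhdsWithin_of_mem_nhds (Iio_mem_nhds htv)]
        with s hs hs'
      exact ⟨hs.1, le_of_lt hs'⟩
    obtain ⟨m, hmR, hlim⟩ := hR.exists_tendsto hT0 hcont hmem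
    classical
    refine ⟨Function.update (fun t => f t t) T m, ?_, ?_, ?_⟩
    · rw [continuousOn_update_iff, Icc_sdiff_right]
      exact ⟨hcont, fun _ => hlim.mono_left (nhdsWithin_mono _ Ico_subset_Iio_self)⟩
    · rw [Function.update_of_ne hT0.ne]
      exact (hf 0 hT0).2
    · intro s hs
      rcases hs.2.eq_or_lt with rfl | hsT
      · simpa using hmR
      · rw [Function.update_of_ne hsT.ne]
        exact hmem s ⟨hs.1, hsT⟩
  · rintro x ⟨⟨σ, hσ⟩, hx0, hx1⟩ y hy
    have hxx : x ∈ Icc 0 x := ⟨hx0, le_rfl⟩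
    obtain ⟨τ, hτx, hτ⟩ := hR.exists_local_section (hσ.3 x hxx) (hu x ⟨hx0, hx1.le⟩ σ hσ)
    obtain ⟨η, hη, hητ⟩ := Metric.eventually_nhds_iff.1 hτ
    have hxy : x < y := hy
    obtain ⟨z, hxz, hzy, hzη⟩ : ∃ z, x < z ∧ z ≤ y ∧ z < x + η := by
      refine ⟨min y (x + η / 2), lt_min hxy (by linarith), min_le_left _ _, ?_⟩
      exact lt_of_le_of_lt (min_le_right _ _) (by linarith)
    have hloc : ∀ s ∈ Icc x z, (s, τ s) ∈ R ∧ ContinuousAt τ s := fun s hs => by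
      refine hητ ?_
      rw [Real.dist_eq, abs_lt]
      constructor <;> linarith [hs.1, hs.2]
    refine ⟨z, ⟨fun s => if s ≤ x then σ s else τ s, ?_, ?_, ?_⟩, hxz, hzy⟩
    · refine ContinuousOn.if ?_ ?_ ?_
      · rintro a ⟨-, ha⟩
        obtain rfl : a = x := by
          have := frontier_le_subset_eq continuous_id continuous_const ha
          simpa using this
        exact hτx.symm
      · refine hσ.1.mono ?_
        rintro a ⟨ha, ha'⟩
        exact ⟨ha.1, (isClosed_Iic (a := x)).closure_subset ha'⟩
      · rintro a ⟨ha, ha'⟩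
        have ha'' : x ≤ a := by
          simp only [not_le] at ha'
          exact closure_lt_subset_le continuous_const continuous_id ha'
        exact (hloc a ⟨ha'', ha.2⟩).2.continuousWithinAt
    · simp only [if_pos hx0]
      exact hσ.2
    · intro s hs
      by_cases hsx : s ≤ x
      · simp only [if_pos hsx]
        exact hσ.3 s ⟨hs.1, hsx⟩
      · simp only [if_neg hsx]
        exact (hloc s ⟨(not_le.1 hsx).le, hs.2⟩).1

/-! ### Monodromy on the unramified part -/

/-- The projection is locally injective by unramifiedness and open because points of `R` persist.
Being unramified is an open condition, so the persisting points stay in the subtype. -/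
theorem IsRootSet.isLocalHomeomorph_unramified {X : Type*} [TopologicalSpace X] {R : Set (X × ℂ)}
    (hR : IsRootSet R) :
    IsLocalHomeomorph (fun e : {q : X × ℂ | q ∈ R ∧ IsUnramifiedAt R q} => (e : X × ℂ).1) := by
  refine isLocalHomeomorph_iff_isOpenEmbedding_restrict.2 ?_
  have hcont : Continuous (fun e : {q : X × ℂ | q ∈ R ∧ IsUnramifiedAt R q} => (e : X × ℂ).1) := by
    fun_prop
  have hopen :
      IsOpenMap (fun e : {q : X × ℂ | q ∈ R ∧ IsUnramifiedAt R q} => (e : X × ℂ).1) := by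
    refine IsOpenMap.of_nhds_le fun e N hN => ?_
    obtain ⟨q, hq, hu⟩ := e
    have hN' := mem_map.1 hN
    rw [nhds_subtype_eq_comap, mem_comap] at hN'
    obtain ⟨O, hO, hON⟩ := hN'
    obtain ⟨W, hW, hinj⟩ := id hu
    obtain ⟨U, hU, V, hV, hUV⟩ := mem_nhds_prod_iff.1 (inter_mem hO (interior_mem_nhds.2 hW))
    obtain ⟨ε, hε, hεV⟩ := Metric.mem_nhds_iff.1 hV
    filter_upwards [hU, hR.eventually_exists q hq ε hε] with x hx ⟨l, hl, hlq⟩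
    have hmem := hUV (⟨hx, hεV (Metric.mem_ball.2 hlq)⟩ : (x, l) ∈ U ×ˢ V)
    have hul : IsUnramifiedAt R (x, l) := ⟨W, mem_interior_iff_mem_nhds.1 hmem.2, hinj⟩
    exact hON (a := ⟨(x, l), hl, hul⟩) hmem.1
  rintro ⟨q, hq, hu⟩
  obtain ⟨W, hW, hinj⟩ := id hu
  have hVo : IsOpen (Subtype.val ⁻¹' interior W :
      Set {q : X × ℂ | q ∈ R ∧ IsUnramifiedAt R q}) :=
    isOpen_interior.preimage continuous_subtype_val
  refine ⟨_, hVo.mem_nhds (mem_interior_iff_mem_nhds.2 hW),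
    .of_continuous_injective_isOpenMap (hcont.comp continuous_subtype_val) ?_
      (hopen.comp hVo.isOpenMap_subtype_val)⟩
  rintro ⟨⟨a, ha, _⟩, haW⟩ ⟨⟨b, hb, _⟩, hbW⟩ hab
  have : a = b := hinj ⟨interior_subset haW, ha⟩ ⟨interior_subset hbW, hb⟩ hab
  subst this
  rfl

theorem IsRootSet.isSeparatedMap_fst {X : Type*} [TopologicalSpace X] (P : Set (X × ℂ)) :
    IsSeparatedMap (fun e : P => (e : X × ℂ).1) := by
  rintro ⟨⟨x, l⟩, hl⟩ ⟨⟨y, m⟩, hm⟩ (rfl : x = y) hne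
  have hlm : l ≠ m := by
    rintro rfl
    exact hne rfl
  obtain ⟨U, V, hU, hV, hlU, hmV, hUV⟩ := t2_separation hlm
  refine ⟨(fun e : P => (e : X × ℂ).2) ⁻¹' U, (fun e : P => (e : X × ℂ).2) ⁻¹' V,
    hU.preimage (by fun_prop), hV.preimage (by fun_prop), hlU, hmV, hUV.preimage _⟩

/-- Path lifting to the unramified part of a root set. -/
theorem IsRootSet.exists_path_lift {X : Type*} [TopologicalSpace X] {R : Set (X × ℂ)}
    (hR : IsRootSet R) {x : X} {l : ℂ} (hl : (x, l) ∈ R)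
    (hu : ∀ q, JoinedIn R (x, l) q → IsUnramifiedAt R q) (γ : C(unitInterval, X))
    (hγ : γ 0 = x) :
    ∃ Γ : C(unitInterval, {q : X × ℂ | q ∈ R ∧ IsUnramifiedAt R q}),
      (Γ 0 : X × ℂ) = (x, l) ∧ ∀ s, (Γ s : X × ℂ).1 = γ s := by
  let g : ℝ → X := Set.IccExtend zero_le_one γ
  have hg : Continuous g := γ.continuous.Icc_extend'
  have hg0 : g 0 = x := by
    rw [← hγ]
    exact Set.IccExtend_left zero_le_one γ
  -- A partial lift, rescaled to the unit interval, is itself a path in `R`, so `hu` applies to its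
  -- endpoint.
  have hjoin : ∀ t ∈ Icc (0 : ℝ) 1, ∀ σ, IsLiftOn {q : ℝ × ℂ | (g q.1, q.2) ∈ R} l σ t →
      JoinedIn R (x, l) (g t, σ t) := by
    intro t ht σ hσ
    have hmaps : ∀ s : unitInterval, (s : ℝ) * t ∈ Icc 0 t := fun s =>
      ⟨mul_nonneg s.2.1 ht.1, mul_le_of_le_one_left ht.1 s.2.2⟩
    have hc : Continuous (fun s : unitInterval => σ ((s : ℝ) * t)) :=
      hσ.1.comp_continuous (by fun_prop) hmaps
    refine ⟨⟨⟨fun s : unitInterval => (g ((s : ℝ) * t), σ ((s : ℝ) * t)), ?_⟩, ?_, ?_⟩, ?_⟩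
    · exact (hg.comp (by fun_prop)).prodMk hc
    · simp [hg0, hσ.2]
    · simp
    · exact fun s => hσ.3 _ (hmaps s)
  obtain ⟨σ, hσ⟩ := (hR.preimage hg).exists_isLiftOn (l := l) (by simpa [hg0] using hl)
    fun t ht σ hσ => (hu _ (hjoin t ht σ hσ)).preimage hg
  refine ⟨⟨fun s => ⟨(g s, σ s), hσ.3 s s.2, hu _ (hjoin s s.2 σ (hσ.mono s.2.2))⟩, ?_⟩, ?_, ?_⟩
  · exact ((hg.comp continuous_subtype_val).prodMk
      (hσ.1.comp_continuous continuous_subtype_val fun s => s.2)).subtype_mk _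
  · simp [hg0, hσ.2]
  · exact fun s => Set.IccExtend_val zero_le_one γ s

/-- Over a simply connected base, a path in a root set that starts and ends over the same base
point is closed, provided that all paths with the same start avoid the ramified points. -/
theorem IsRootSet.eq_of_joinedIn {X : Type*} [TopologicalSpace X] [SimplyConnectedSpace X]
    {R : Set (X × ℂ)} (hR : IsRootSet R) {x : X} {l m : ℂ} (hlm : JoinedIn R (x, l) (x, m))
    (hu : ∀ q, JoinedIn R (x, l) q → IsUnramifiedAt R q) : l = m := by
  classical
  obtain ⟨δ, hδ⟩ := hlm
  have hl : (x, l) ∈ R := by simpa using hδ 0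
  let γ : Path x x := δ.map continuous_fst
  obtain ⟨H⟩ := SimplyConnectedSpace.paths_homotopic γ (Path.refl x)
  have hjoin : ∀ s, JoinedIn R (x, l) (δ s) := fun s =>
    ⟨(δ.truncateOfLE s.2.1).cast (by simp) (by simp), fun u => by
      simp only [Path.cast_coe]
      obtain ⟨v, hv⟩ := δ.truncate_range (t₀ := 0) (t₁ := s) (mem_range_self u)
      exact hv ▸ hδ v⟩
  -- Each slice of the homotopy is lifted separately: the first by `δ`, the last by a constant path,
  -- so that their endpoints are known. The monodromy theorem needs no continuity in `t`.
  have hlift : ∀ t : unitInterval,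
      ∃ Γ : C(unitInterval, {q : X × ℂ | q ∈ R ∧ IsUnramifiedAt R q}),
        (Γ 0 : X × ℂ) = (x, l) ∧ (∀ s, (Γ s : X × ℂ).1 = H (t, s)) ∧
        (t = 0 → (Γ 1 : X × ℂ) = (x, m)) ∧ (t = 1 → (Γ 1 : X × ℂ) = (x, l)) := by
    intro t
    by_cases h0 : t = 0
    · subst h0
      exact ⟨⟨fun s => ⟨δ s, hδ s, hu _ (hjoin s)⟩, by fun_prop⟩, by simp, by simp [γ], by simp,
        by simp⟩
    by_cases h1 : t = 1
    · subst h1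
      exact ⟨.const _ ⟨(x, l), hl, hu _ (.refl hl)⟩, rfl, by simp, by simp, fun _ => rfl⟩
    obtain ⟨Γ, hΓ, hΓ'⟩ := hR.exists_path_lift hl hu (H.curry t) (by simp)
    exact ⟨Γ, hΓ, hΓ', fun h => absurd h h0, fun h => absurd h h1⟩
  choose Γ hΓ0 hΓ hΓm hΓl using hlift
  have := hR.isLocalHomeomorph_unramified.monodromy_theorem (IsRootSet.isSeparatedMap_fst _) H Γ hΓ
    (fun t => Subtype.ext ((hΓ0 t).trans (hΓ0 0).symm)) 1
  have h2 := congrArg (fun e : {q : X × ℂ | q ∈ R ∧ IsUnramifiedAt R q} => (e : X × ℂ).2) this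
  simpa [hΓm 0 rfl, hΓl 1 rfl] using h2

/-- A root set whose fibres all have the same number of points is unramified. -/
theorem IsRootSet.isUnramifiedAt_of_ncard_eq {X : Type*} [TopologicalSpace X] {R : Set (X × ℂ)}
    (hR : IsRootSet R) (hcard : ∀ x y, {l | (x, l) ∈ R}.ncard = {l | (y, l) ∈ R}.ncard)
    {q : X × ℂ} (hq : q ∈ R) : IsUnramifiedAt R q := by
  -- Disjoint neighbourhoods of the points of one fibre each contain a point of every nearby fibre;
  -- equal cardinality leaves room for exactly one.
  obtain ⟨U, hU, hdisj⟩ := (hR.finite_fiber q.1).t2_separation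
  have hev : ∀ᶠ x in 𝓝 q.1, ∀ m ∈ {l | (q.1, l) ∈ R}, ∃ l, (x, l) ∈ R ∧ l ∈ U m := by
    refine (eventually_all_finite (hR.finite_fiber q.1)).2 fun m hm => ?_
    obtain ⟨ε, hε, hεU⟩ := Metric.isOpen_iff.1 (hU m).2 m (hU m).1
    filter_upwards [hR.eventually_exists (q.1, m) hm ε hε] with x ⟨l, hl, hlm⟩
    exact ⟨l, hl, hεU hlm⟩
  refine ⟨{x | ∀ m ∈ {l | (q.1, l) ∈ R}, ∃ l, (x, l) ∈ R ∧ l ∈ U m} ×ˢ U q.2,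
    prod_mem_nhds hev ((hU q.2).2.mem_nhds (hU q.2).1), ?_⟩
  have huniq : ∀ x, (∀ m ∈ {l | (q.1, l) ∈ R}, ∃ l, (x, l) ∈ R ∧ l ∈ U m) →
      ∃ f : ℂ → ℂ, ∀ l, (x, l) ∈ R → l ∈ U q.2 → l = f q.2 := by
    intro x hx
    choose! f hfR hfU using hx
    have hinj : InjOn f {l | (q.1, l) ∈ R} := by
      intro a ha b hb hab
      by_contra hne
      exact disjoint_left.1 (hdisj ha hb hne) (hfU a ha) (hab ▸ hfU b hb)
    have himg : f '' {l | (q.1, l) ∈ R} = {l | (x, l) ∈ R} := by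
      refine eq_of_subset_of_ncard_le (image_subset_iff.2 hfR) ?_ (hR.finite_fiber x)
      rw [hinj.ncard_image, hcard]
    refine ⟨f, fun l hl hlU => ?_⟩
    obtain ⟨m, hm, rfl⟩ := himg.ge hl
    by_contra hne
    have hmq : m ≠ q.2 := by
      rintro rfl
      exact hne rfl
    exact disjoint_left.1 (hdisj hm hq hmq) (hfU m hm) hlU
  rintro ⟨x, l⟩ ⟨⟨hx, hl⟩, hlR⟩ ⟨y, m⟩ ⟨⟨-, hm⟩, hmR⟩ (rfl : x = y)
  obtain ⟨f, hf⟩ := huniq x hx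
  rw [hf l hlR hl, hf m hmR hm]

/-! ### Eigenvalues as a root set -/

namespace EigenSurface

theorem continuous_eval_charpoly {n : ℕ} :
    Continuous fun q : Matrix (Fin n) (Fin n) ℂ × ℂ => q.1.charpoly.eval q.2 := by
  simp_rw [Matrix.eval_charpoly, Matrix.scalar_apply]
  refine Continuous.matrix_det (Continuous.sub ?_ continuous_fst)
  exact Continuous.matrix_diagonal (by fun_prop)

theorem exists_eventually_norm_le_of_isRoot {n : ℕ} (M : Matrix (Fin n) (Fin n) ℂ) :
    ∃ C : ℝ, ∀ᶠ N in 𝓝 M, ∀ l, N.charpoly.IsRoot l → ‖l‖ ≤ C := by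
  let _ := Matrix.linftyOpNormedRing (n := Fin n) (α := ℂ)
  let _ := Matrix.linftyOpNormedAlgebra (n := Fin n) (R := ℂ) (α := ℂ)
  have hc : Continuous fun N : Matrix (Fin n) (Fin n) ℂ =>
    ‖N‖ * ‖(1 : Matrix (Fin n) (Fin n) ℂ)‖ := by fun_prop
  refine ⟨‖M‖ * ‖(1 : Matrix (Fin n) (Fin n) ℂ)‖ + 1, ?_⟩
  filter_upwards [hc.continuousAt.eventually (gt_mem_nhds (lt_add_one _))] with N hN l hl
  exact (spectrum.norm_le_norm_mul_of_mem
    (Matrix.mem_spectrum_iff_isRoot_charpoly.2 hl)).trans hN.le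

/-- A monic complex polynomial that is small at `z` has a root near `z`. -/
theorem exists_isRoot_dist_lt {p : Polynomial ℂ} (hp : p.Monic) {z : ℂ} {ε : ℝ} (hε : 0 < ε)
    (h : ‖p.eval z‖ < ε ^ p.natDegree) : ∃ l, p.IsRoot l ∧ dist l z < ε := by
  by_contra! hcon
  refine absurd h (not_lt.2 ?_)
  have hs := IsAlgClosed.splits p
  -- If all roots were at distance at least `ε` from `z`, each linear factor would contribute at
  -- least `ε`.
  rw [hs.eval_eq_prod_roots_of_monic hp, hs.natDegree_eq_card_roots]
  have key : ∀ s : Multiset ℂ, (∀ l ∈ s, ε ≤ dist l z) →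
      ε ^ s.card ≤ ‖(s.map fun l => z - l).prod‖ := by
    intro s
    induction s using Multiset.induction_on with
    | empty => simp
    | cons a s ih =>
      intro hs
      rw [Multiset.card_cons, pow_succ', Multiset.map_cons, Multiset.prod_cons, norm_mul]
      have ha := hs a (Multiset.mem_cons_self a s)
      rw [dist_comm, dist_eq_norm] at ha
      gcongr
      exact ih fun l hl => hs l (Multiset.mem_cons_of_mem hl)
  exact key _ fun l hl => hcon l (Polynomial.isRoot_of_mem_roots hl)

/-- The eigenvalues of matrices form a root set. -/
theorem isRootSet_charpoly (n : ℕ) :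
    IsRootSet {q : Matrix (Fin n) (Fin n) ℂ × ℂ | q.1.charpoly.IsRoot q.2} where
  isClosed := isClosed_eq continuous_eval_charpoly continuous_const
  finite_fiber M := Polynomial.finite_setOfPred_isRoot M.charpoly_monic.ne_zero
  locally_bounded M := exists_eventually_norm_le_of_isRoot M
  eventually_exists := by
    rintro ⟨M, l⟩ hl ε hε
    have hl' : M.charpoly.eval l = 0 := hl
    have hc : Continuous fun N : Matrix (Fin n) (Fin n) ℂ => ‖N.charpoly.eval l‖ :=
      (continuous_eval_charpoly.comp (Continuous.prodMk_left l)).norm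
    have h0 : ‖M.charpoly.eval l‖ < ε ^ n := by
      rw [hl', norm_zero]
      positivity
    filter_upwards [hc.continuousAt.eventually (gt_mem_nhds h0)] with N hN
    exact exists_isRoot_dist_lt N.charpoly_monic hε
      (by simpa [Matrix.charpoly_natDegree_eq_dim] using hN)

/-- The set of eigenvalues is unramified at a simple eigenvalue. -/
theorem isUnramifiedAt_of_algMult_le_one {n : ℕ} {M : Matrix (Fin n) (Fin n) ℂ} {l : ℂ}
    (hl : M.charpoly.IsRoot l) (hm : algMult M l ≤ 1) :
    IsUnramifiedAt {q : Matrix (Fin n) (Fin n) ℂ × ℂ | q.1.charpoly.IsRoot q.2} (M, l) := by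
  have hd : M.charpoly.derivative.eval l ≠ 0 := fun h => not_lt.2 hm
    ((Polynomial.one_lt_rootMultiplicity_iff_isRoot M.charpoly_monic.ne_zero).2 ⟨hl, h⟩)
  let _ := Matrix.linftyOpNormedRing (n := Fin n) (α := ℂ)
  let _ := Matrix.linftyOpNormedAlgebra (n := Fin n) (R := ℂ) (α := ℂ)
  let F : Matrix (Fin n) (Fin n) ℂ × ℂ → ℂ := fun q => q.1.charpoly.eval q.2
  have hentry : ∀ i j, ContDiff ℂ 1 fun q : Matrix (Fin n) (Fin n) ℂ × ℂ => q.1 i j := fun i j =>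
    (LinearMap.toContinuousLinearMap
      (Matrix.entryLinearMap ℂ ℂ i j : Matrix (Fin n) (Fin n) ℂ →ₗ[ℂ] ℂ)).contDiff.comp
      contDiff_fst
  have hF : ContDiff ℂ 1 F := by
    have : F = fun q => ∑ σ : Equiv.Perm (Fin n), ((Equiv.Perm.sign σ : ℤ) : ℂ) *
        ∏ i, ((if σ i = i then q.2 else 0) - q.1 (σ i) i) := by
      funext q
      simp only [F, Matrix.eval_charpoly, Matrix.det_apply', Matrix.sub_apply,
        Matrix.scalar_apply, Matrix.diagonal_apply]
    rw [this]
    refine ContDiff.sum fun σ _ => contDiff_const.mul (contDiff_prod fun i _ => ?_)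
    refine ContDiff.sub ?_ (hentry _ _)
    split_ifs
    · exact contDiff_snd
    · exact contDiff_const
  have hstrict := hF.contDiffAt.hasStrictFDerivAt (x := (M, l)) one_ne_zero
  have hderiv : fderiv ℂ F (M, l) (0, 1) = M.charpoly.derivative.eval l := by
    have h1 : HasDerivAt (fun z => F (M, z)) (fderiv ℂ F (M, l) (0, 1)) l :=
      hstrict.hasFDerivAt.comp_hasDerivAt l ((hasDerivAt_const l M).prodMk (hasDerivAt_id l))
    exact h1.unique (M.charpoly.hasDerivAt l)
  -- Strict differentiability with half the derivative as error constant: two nearby roots `a`, `b`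
  -- of one matrix satisfy `‖a - b‖ * D ≤ (D / 2) * ‖a - b‖` with `D > 0`, hence coincide.
  have hpos : 0 < ‖M.charpoly.derivative.eval l‖ / 2 := by positivity
  have hev := hstrict.isLittleO.def hpos
  rw [nhds_prod_eq] at hev
  obtain ⟨W, hW, hWF⟩ := eventually_prod_self_iff'.1 hev
  refine ⟨W, hW, ?_⟩
  rintro ⟨N, a⟩ ⟨ha, haR⟩ ⟨N', b⟩ ⟨hb, hbR⟩ (rfl : N = N')
  have h := hWF _ ha _ hb
  have ha0 : F (N, a) = 0 := haR
  have hb0 : F (N, b) = 0 := hbR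
  have hval : fderiv ℂ F (M, l) ((N, a) - (N, b)) =
      (a - b) * M.charpoly.derivative.eval l := by
    have hab : ((N, a) : Matrix (Fin n) (Fin n) ℂ × ℂ) - (N, b) = (a - b) • (0, 1) := by
      ext <;> simp
    rw [hab, map_smul, smul_eq_mul]
    exact congrArg _ hderiv
  have hnorm : ‖((N, a) : Matrix (Fin n) (Fin n) ℂ × ℂ) - (N, b)‖ = ‖a - b‖ := by
    simp [Prod.norm_def]
  replace h := (congrArg norm (by rw [ha0, hb0, hval, sub_self, zero_sub] :
    F (N, a) - F (N, b) - fderiv ℂ F (M, l) ((N, a) - (N, b)) = _)).ge.trans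
    (h.trans (congrArg _ hnorm).le)
  rw [norm_neg, norm_mul] at h
  have : ‖a - b‖ = 0 := by
    have := norm_nonneg (a - b)
    nlinarith
  rw [norm_eq_zero, sub_eq_zero] at this
  rw [this]

/-- Every root has multiplicity between `1` and `n`, and the index `j < n` stands for multiplicity
`n - j`. Hence the list determines the number of distinct eigenvalues. -/
theorem ncard_isRoot_charpoly {n : ℕ} (M : Matrix (Fin n) (Fin n) ℂ) :
    {l | M.charpoly.IsRoot l}.ncard = ∑ j, multiplicityList M j := by
  classical
  have hne := M.charpoly_monic.ne_zero
  have hroots : ∀ l, l ∈ M.charpoly.roots.toFinset ↔ M.charpoly.IsRoot l := fun l => by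
    simp [hne]
  have hset : {l | M.charpoly.IsRoot l} = M.charpoly.roots.toFinset := by
    ext l
    simp [hne]
  have hle : ∀ l, algMult M l ≤ n := fun l => by
    have h := (Multiset.count_le_card l M.charpoly.roots).trans (Polynomial.card_roots' _)
    rwa [Polynomial.count_roots, Matrix.charpoly_natDegree_eq_dim, Fintype.card_fin] at h
  have hpos : ∀ l, M.charpoly.IsRoot l → 0 < algMult M l := fun l hl =>
    (Polynomial.rootMultiplicity_pos hne).2 hl
  have hmaps : ∀ l ∈ M.charpoly.roots.toFinset, n - algMult M l ∈ Finset.range n := by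
    intro l hl
    have h1 := hle l
    have h2 := hpos l ((hroots l).1 hl)
    rw [Finset.mem_range]
    omega
  rw [hset, ncard_coe_finset, Finset.card_eq_sum_card_fiberwise hmaps, Finset.sum_range]
  refine Finset.sum_congr rfl fun j _ => ?_
  rw [multiplicityList, numEigen, ← ncard_coe_finset]
  congr 1
  ext l
  simp only [Finset.coe_filter, mem_ofPred_eq, hroots, Matrix.mem_spectrum_iff_isRoot_charpoly]
  have h1 := hle l
  have h2 := j.2
  exact and_congr_right fun _ => by omega

/-! ### Transfer between the eigen-surface and the relation over `S` -/

/-- The eigenvalues of the matrices of `S`, as a relation over `S`. -/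
theorem isRootSet_subtype {n : ℕ} (S : Set (Matrix (Fin n) (Fin n) ℂ)) :
    IsRootSet {q : S × ℂ | (q.1 : Matrix (Fin n) (Fin n) ℂ).charpoly.IsRoot q.2} :=
  (isRootSet_charpoly n).preimage (g := ((↑) : S → Matrix (Fin n) (Fin n) ℂ)) continuous_subtype_val

theorem continuous_comb {n d : ℕ} (b : Fin d → Matrix (Fin n) (Fin n) ℂ) :
    Continuous (comb b) := by
  unfold comb
  fun_prop

/-- Linearly independent matrices give continuous coordinates on their span. -/
theorem exists_continuous_leftInverse_comb {n d : ℕ} {b : Fin d → Matrix (Fin n) (Fin n) ℂ}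
    (hb : LinearIndependent ℂ b) :
    ∃ g : Matrix (Fin n) (Fin n) ℂ → Fin d → ℂ, Continuous g ∧ (∀ α, g (comb b α) = α) ∧
      ∀ M ∈ Submodule.span ℂ (Set.range b), comb b (g M) = M := by
  obtain ⟨g, hg⟩ := (Fintype.linearCombination ℂ b).exists_leftInverse_of_injective
    (LinearMap.ker_eq_bot.2 (linearIndependent_iff_injective_fintypeLinearCombination.1 hb))
  have hg' : ∀ α, g (comb b α) = α := fun α => LinearMap.congr_fun hg α
  refine ⟨g, g.continuous_of_finiteDimensional, hg', fun M hM => ?_⟩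
  obtain ⟨α, rfl⟩ := (Submodule.mem_span_range_iff_exists_fun ℂ).1 hM
  exact congrArg (comb b) (hg' α)

theorem Paired.joinedIn {n d : ℕ} {b : Fin d → Matrix (Fin n) (Fin n) ℂ}
    {S : Set (Matrix (Fin n) (Fin n) ℂ)} {p q : (Fin d → ℂ) × ℂ} (h : Paired b S p q) :
    JoinedIn (eigenSurface b S) p q := by
  obtain ⟨K, ⟨r, -, rfl⟩, hp, hq⟩ := h
  exact JoinedIn.trans (JoinedIn.symm hp) hq

/-- A path in the eigen-surface of a subset of `S` gives a path of eigenvalues over `S`. -/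
theorem joinedIn_of_joinedIn_eigenSurface {n d : ℕ} {b : Fin d → Matrix (Fin n) (Fin n) ℂ}
    {S T : Set (Matrix (Fin n) (Fin n) ℂ)} (hTS : T ⊆ S) {α : Fin d → ℂ} {l m : ℂ}
    (hα : comb b α ∈ S) (h : JoinedIn (eigenSurface b T) (α, l) (α, m)) :
    JoinedIn {q : S × ℂ | (q.1 : Matrix (Fin n) (Fin n) ℂ).charpoly.IsRoot q.2}
      (⟨comb b α, hα⟩, l) (⟨comb b α, hα⟩, m) := by
  obtain ⟨δ, hδ⟩ := h
  refine ⟨⟨⟨fun s => (⟨comb b (δ s).1, hTS (hδ s).1⟩, (δ s).2), ?_⟩, ?_, ?_⟩, fun s => ?_⟩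
  · exact (((continuous_comb b).comp (by fun_prop)).subtype_mk _).prodMk (by fun_prop)
  · simp
  · simp
  · exact Matrix.mem_spectrum_iff_isRoot_charpoly.1 (hδ s).2

/-- A path of eigenvalues over `S` is a path in the eigen-surface of `S`. -/
theorem joinedIn_eigenSurface {n d : ℕ} {b : Fin d → Matrix (Fin n) (Fin n) ℂ}
    {S : Set (Matrix (Fin n) (Fin n) ℂ)} (hb : LinearIndependent ℂ b)
    (hS : S ⊆ Submodule.span ℂ (Set.range b)) {α : Fin d → ℂ} {l : ℂ} (hα : comb b α ∈ S)
    {q : S × ℂ}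
    (h : JoinedIn {q : S × ℂ | (q.1 : Matrix (Fin n) (Fin n) ℂ).charpoly.IsRoot q.2}
      (⟨comb b α, hα⟩, l) q) :
    ∃ β, comb b β = q.1 ∧ JoinedIn (eigenSurface b S) (α, l) (β, q.2) := by
  obtain ⟨g, hgc, hg, hg'⟩ := exists_continuous_leftInverse_comb hb
  obtain ⟨δ, hδ⟩ := h
  refine ⟨g q.1, hg' _ (hS q.1.2),
    ⟨⟨fun s => (g (δ s).1, (δ s).2), ?_⟩, ?_, ?_⟩, fun s => ⟨?_, ?_⟩⟩
  · exact (hgc.comp (by fun_prop)).prodMk (by fun_prop)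
  · simp [hg]
  · simp
  · simp only [Path.coe_mk_mk, hg' _ (hS (δ s).1.2), Subtype.coe_prop]
  · simp only [Path.coe_mk_mk, hg' _ (hS (δ s).1.2)]
    exact Matrix.mem_spectrum_iff_isRoot_charpoly.2 (hδ s)

/-! ### The two monodromy arguments and the theorem -/

/-- A subset of a simply connected set of matrices with equal multiplicity lists is transitive. -/
theorem isTransitive_of_multiplicityList_eq {n : ℕ} {S T : Set (Matrix (Fin n) (Fin n) ℂ)}
    (hS : IsSimplyConnected S) (hTS : T ⊆ S)
    (hmult : ∀ B ∈ S, ∀ C ∈ S, multiplicityList B = multiplicityList C) {d : ℕ}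
    (b : Fin d → Matrix (Fin n) (Fin n) ℂ) : IsTransitive b T := by
  intro α l m hα hp
  have := hS.simplyConnectedSpace
  refine (isRootSet_subtype S).eq_of_joinedIn
    (joinedIn_of_joinedIn_eigenSurface hTS (hTS hα) hp.joinedIn) fun q hq =>
    (isRootSet_subtype S).isUnramifiedAt_of_ncard_eq (fun B C => ?_) hq.target_mem
  refine (ncard_isRoot_charpoly B.1).trans (Eq.trans ?_ (ncard_isRoot_charpoly C.1).symm)
  rw [hmult B B.2 C C.2]

/-- In a simply connected set of matrices, a component of the eigen-surface all of whose
eigenvalues are simple contains at most one eigenvalue of each matrix. -/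
theorem eq_of_joinedIn_of_algMult_le_one {n d : ℕ} {S : Set (Matrix (Fin n) (Fin n) ℂ)}
    (hS : IsSimplyConnected S) {b : Fin d → Matrix (Fin n) (Fin n) ℂ}
    (hb : IsRepresentation S b) {α : Fin d → ℂ} {l m : ℂ}
    (h : JoinedIn (eigenSurface b S) (α, l) (α, m))
    (hsimple : ∀ β μ, JoinedIn (eigenSurface b S) (α, l) (β, μ) → algMult (comb b β) μ ≤ 1) :
    l = m := by
  have := hS.simplyConnectedSpace
  have hα : comb b α ∈ S := h.source_mem.1
  refine (isRootSet_subtype S).eq_of_joinedIn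
    (joinedIn_of_joinedIn_eigenSurface subset_rfl hα h) fun q hq => ?_
  obtain ⟨β, hβ, hj⟩ := joinedIn_eigenSurface hb.1 hb.2 hα hq
  refine IsUnramifiedAt.preimage (g := ((↑) : S → Matrix (Fin n) (Fin n) ℂ))
    (R := {q : Matrix (Fin n) (Fin n) ℂ × ℂ | q.1.charpoly.IsRoot q.2}) continuous_subtype_val ?_
  exact isUnramifiedAt_of_algMult_le_one hq.target_mem (hβ ▸ hsimple β q.2 hj)

end EigenSurface

end

theorem mainTheorem3 (n : ℕ) (S : Set (Matrix (Fin n) (Fin n) ℂ)) (hS : IsSimplyConnected S) :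
    (∀ (A₀ : Matrix (Fin n) (Fin n) ℂ) (A : Path A₀ A₀), (∀ x, A x ∈ S) →
      ∀ (d : ℕ) (b : Fin d → Matrix (Fin n) (Fin n) ℂ),
        EigenSurface.IsRepresentation (Set.range A) b →
        ¬ EigenSurface.IsTransitive b (Set.range A) →
        ∃ B ∈ S, ∃ C ∈ S, EigenSurface.multiplicityList B ≠ EigenSurface.multiplicityList C) ∧
    (∀ (d : ℕ) (b : Fin d → Matrix (Fin n) (Fin n) ℂ),
      EigenSurface.IsRepresentation S b →
      ∀ (k : ℕ) (K : Set ((Fin d → ℂ) × ℂ)), 1 < k → EigenSurface.IsKComponent b S k K →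
        ∃ (α : Fin d → ℂ) (l : ℂ), (α, l) ∈ K ∧
          1 < EigenSurface.algMult (EigenSurface.comb b α) l) := by
  classical
  constructor
  · intro A₀ A hA d b _ hnt
    by_contra! hcon
    exact hnt (EigenSurface.isTransitive_of_multiplicityList_eq hS
      (Set.range_subset_iff.2 hA) hcon b)
  · rintro d b hb k K hk ⟨⟨p, hp, rfl⟩, α, hα, hcount⟩
    by_contra! hcon
    rw [← hcount, EigenSurface.countIn] at hk
    -- With only simple eigenvalues in the component, counting with multiplicity is counting
    -- distinct eigenvalues, so `k > 1` would give two different ones.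
    have hnodup : ((EigenSurface.comb b α).charpoly.roots.filter
        fun l => (α, l) ∈ pathComponentIn (EigenSurface.eigenSurface b S) p).Nodup := by
      refine Multiset.nodup_iff_count_le_one.2 fun l => ?_
      rw [Multiset.count_filter]
      split_ifs with hl
      · rw [Polynomial.count_roots]
        exact hcon α l hl
      · exact zero_le_one
    rw [← Multiset.toFinset_card_of_nodup hnodup] at hk
    refine not_le.2 hk (Finset.card_le_one.2 fun l hl m hm => ?_)
    have hl' := (Multiset.mem_filter.1 (Multiset.mem_toFinset.1 hl)).2
    have hm' := (Multiset.mem_filter.1 (Multiset.mem_toFinset.1 hm)).2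
    exact EigenSurface.eq_of_joinedIn_of_algMult_le_one hS hb
      (JoinedIn.trans (JoinedIn.symm hl') hm')
      fun β μ h => hcon β μ (JoinedIn.trans hl' h)
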